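/- For a commutative $\mathbb{C}$-algebra $A$ that is either $\mathbb{C}[x_1,\dots,x_n]$ or the local ring $\mathcal{O}_{\mathbb{C}^n,q}$ of $\mathbb{C}^n$ at a point $q$ (the localization of $\mathbb{C}[x_1,\dots,x_n]$ at the maximal ideal of $q$), let $\mathcal{D}_A = A\langle \partial_1,\dots,\partial_n\rangle$ be the ring of differential operators with coefficients in $A$. For $f \in A$, let $\mathcal{D}_A[s]$ act on $A_f[s]f^s$ by $\partial_i(g f^s) = \left(\partial_i(g) + s\,g\,\partial_i(f)/f\right) f^s$. For a polynomial $f$, the $b$-function $b_f(s)$ is the (monic) minimal polynomial of the operator $s$ on $\mathcal{D}_A[s]f^s/\mathcal{D}_A[s]f^{s+1}$ with $A = \mathbb{C}[x_1,\dots,x_n]$, and the local $b$-function $b_{f,q}(s)$ of $f$ at $q$ is the minimal polynomial of $s$ on the same quotient formed with $A = \mathcal{O}_{\mathbb{C}^n,q}$. For $S \subseteq \{1,\dots,n\}$ put $\xi_S = \prod_{i<j,\ i,j\in S}(x_i - x_j)$, put $\xi_n = \xi_{\{1,\dots,n\}}$, and for a set partition $P = \{P_1,\dots,P_r\}$ of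 $\{1,\dots,n\}$ put $\xi_P = \prod_{t=1}^r \xi_{P_t} \in \mathbb{C}[x_1,\dots,x_n]$. Let $q = (q_1,\dots,q_n) \in \mathbb{C}^n$, and let $P$ be the set partition of $\{1,\dots,n\}$ such that $i$ and $j$ lie in the same block if and only if $q_i = q_j$. Then $$b_{\xi_n,q}(s) = b_{\xi_P}(s).$$ -/

import Mathlib

open scoped Polynomial

noncomputable section

namespace BernsteinSato

/-! ### Derivations on localizations and on polynomial rings -/

section Derivations

variable {A : Type*} [CommRing A] [Algebra ℂ A]

/-- The algebra homomorphism `a ↦ a + δ(a) ε` from `A` to the dual numbers over `B`. -/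
def toDual (B : Type*) [CommRing B] [Algebra ℂ B] [Algebra A B] [IsScalarTower ℂ A B]
    (δ : Derivation ℂ A A) : A →ₐ[ℂ] TrivSqZeroExt B B where
  toFun a := TrivSqZeroExt.inl (algebraMap A B a) + TrivSqZeroExt.inr (algebraMap A B (δ a))
  map_one' := by ext <;> simp
  map_zero' := by ext <;> simp
  map_mul' a b := by
    ext
    · simp
    · simp only [Derivation.leibniz, smul_eq_mul, map_add, map_mul, TrivSqZeroExt.snd_add,
        TrivSqZeroExt.snd_inl, TrivSqZeroExt.snd_inr, TrivSqZeroExt.snd_mul,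
        TrivSqZeroExt.fst_add, TrivSqZeroExt.fst_inl, TrivSqZeroExt.fst_inr,
        MulOpposite.smul_eq_mul_unop, MulOpposite.unop_op]
      ring
  map_add' a b := by ext <;> simp only [map_add, TrivSqZeroExt.snd_add, TrivSqZeroExt.fst_add,
    TrivSqZeroExt.fst_inl, TrivSqZeroExt.fst_inr, TrivSqZeroExt.snd_inl, TrivSqZeroExt.snd_inr] <;>
    ring
  commutes' c := by
    ext <;> simp [← IsScalarTower.algebraMap_apply, TrivSqZeroExt.algebraMap_eq_inl']

theorem isUnit_toDual (M : Submonoid A) (B : Type*) [CommRing B] [Algebra ℂ B] [Algebra A B]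
    [IsScalarTower ℂ A B] [IsLocalization M B] (δ : Derivation ℂ A A) (m : M) :
    IsUnit (toDual B δ m) := by
  rw [TrivSqZeroExt.isUnit_iff_isUnit_fst]
  simpa [toDual] using IsLocalization.map_units B m

/-- The extension of `toDual` to a localization `B` of `A`. -/
def toDualLoc (M : Submonoid A) (B : Type*) [CommRing B] [Algebra ℂ B] [Algebra A B]
    [IsScalarTower ℂ A B] [IsLocalization M B] (δ : Derivation ℂ A A) :
    B →ₐ[ℂ] TrivSqZeroExt B B :=
  IsLocalization.liftAlgHom (M := M) (f := toDual B δ) (isUnit_toDual M B δ)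

theorem toDualLoc_algebraMap (M : Submonoid A) (B : Type*) [CommRing B] [Algebra ℂ B]
    [Algebra A B] [IsScalarTower ℂ A B] [IsLocalization M B] (δ : Derivation ℂ A A) (a : A) :
    toDualLoc M B δ (algebraMap A B a) = toDual B δ a := by
  simp [toDualLoc]

theorem fst_toDualLoc (M : Submonoid A) (B : Type*) [CommRing B] [Algebra ℂ B]
    [Algebra A B] [IsScalarTower ℂ A B] [IsLocalization M B] (δ : Derivation ℂ A A) (b : B) :
    (toDualLoc M B δ b).fst = b := by
  have h : (TrivSqZeroExt.fstHom ℂ B B).toRingHom.comp (toDualLoc M B δ).toRingHom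
      = RingHom.id B := by
    apply IsLocalization.ringHom_ext M
    ext a
    have := toDualLoc_algebraMap M B δ a
    simp [this, toDual]
  exact congrArg (fun g => g b) h

/-- The unique extension of a derivation of `A` to a localization `B` of `A`
(given by the quotient rule). -/
def extendDer (M : Submonoid A) (B : Type*) [CommRing B] [Algebra ℂ B]
    [Algebra A B] [IsScalarTower ℂ A B] [IsLocalization M B] (δ : Derivation ℂ A A) :
    Derivation ℂ B B :=
  Derivation.mk' ((TrivSqZeroExt.sndHom B B).restrictScalars ℂ ∘ₗ (toDualLoc M B δ).toLinearMap)
    (fun a b => by simp [fst_toDualLoc, mul_comm])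

theorem extendDer_algebraMap (M : Submonoid A) (B : Type*) [CommRing B] [Algebra ℂ B]
    [Algebra A B] [IsScalarTower ℂ A B] [IsLocalization M B] (δ : Derivation ℂ A A) (a : A) :
    extendDer M B δ (algebraMap A B a) = algebraMap A B (δ a) := by
  change (toDualLoc M B δ (algebraMap A B a)).snd = _
  rw [toDualLoc_algebraMap]
  change TrivSqZeroExt.snd (TrivSqZeroExt.inl (algebraMap A B a) +
    TrivSqZeroExt.inr (algebraMap A B (δ a))) = _
  rw [TrivSqZeroExt.snd_add, TrivSqZeroExt.snd_inl, TrivSqZeroExt.snd_inr, zero_add]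

theorem derivation_ext_loc {A : Type*} [CommRing A] (M : Submonoid A) {B : Type*} [CommRing B] [Algebra ℂ B]
    [Algebra A B] [IsLocalization M B] {D E : Derivation ℂ B B}
    (h : ∀ a : A, D (algebraMap A B a) = E (algebraMap A B a)) : D = E := by
  ext b
  obtain ⟨⟨a, m⟩, hm⟩ := IsLocalization.surj M b
  have hu := IsLocalization.map_units B m
  have h1 := congrArg D hm
  have h2 := congrArg E hm
  rw [Derivation.leibniz] at h1 h2
  simp only [smul_eq_mul] at h1 h2
  rw [← hu.mul_right_inj]
  rw [h, h] at h1
  linear_combination h1 - h2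

theorem extendDer_comm (M : Submonoid A) (B : Type*) [CommRing B] [Algebra ℂ B]
    [Algebra A B] [IsScalarTower ℂ A B] [IsLocalization M B] {δ ε : Derivation ℂ A A}
    (h : ∀ a, δ (ε a) = ε (δ a)) (b : B) :
    extendDer M B δ (extendDer M B ε b) = extendDer M B ε (extendDer M B δ b) := by
  have : ⁅extendDer M B δ, extendDer M B ε⁆ = 0 := by
    apply derivation_ext_loc M
    intro a
    simp [Derivation.commutator_apply, extendDer_algebraMap, h]
  have h2 := congrArg (fun D => D b) this
  simpa [Derivation.commutator_apply, sub_eq_zero] using h2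

/-- The derivation of `A[s]` applying a derivation of `A` to each coefficient. -/
def coeffDer (δ : Derivation ℂ A A) : Derivation ℂ A[X] A[X] :=
  Derivation.mk'
    { toFun := fun p => PolynomialModule.equivPolynomialSelf (δ.mapCoeffs p)
      map_add' := fun p q => by rw [map_add, map_add]
      map_smul' := fun c p => by
        ext; simp [PolynomialModule.equivPolynomialSelf] }
    (fun p q => by
      simp only [LinearMap.coe_mk, AddHom.coe_mk]
      rw [Derivation.leibniz, map_add, map_smul, map_smul])

theorem coeff_coeffDer (δ : Derivation ℂ A A) (p : A[X]) (k : ℕ) :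
    (coeffDer δ p).coeff k = δ (p.coeff k) := rfl

end Derivations

/-! ### Rings of differential operators -/

/-- A finite family of pairwise commuting derivations of a `ℂ`-algebra: the partial derivatives
`∂₁, …, ∂ₙ` in a system of coordinates. -/
structure Partials (n : ℕ) (A : Type*) [CommRing A] [Algebra ℂ A] where
  /-- the `i`-th partial derivative -/
  der : Fin n → Derivation ℂ A A
  /-- partial derivatives commute -/
  comm : ∀ i j a, der i (der j a) = der j (der i a)

/-- The partial derivatives induced on a localization. -/
def Partials.localize {n : ℕ} {A : Type*} [CommRing A] [Algebra ℂ A] (d : Partials n A)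
    (M : Submonoid A) (B : Type*) [CommRing B] [Algebra ℂ B] [Algebra A B]
    [IsScalarTower ℂ A B] [IsLocalization M B] : Partials n B where
  der i := extendDer M B (d.der i)
  comm i j b := extendDer_comm M B (d.comm i j) b

section DiffOp

variable {n : ℕ} {A : Type*} [CommRing A] [Algebra ℂ A]

/-- The relations between the generators `a ∈ A` and `∂₁, …, ∂ₙ` of the ring of differential
operators: those of the algebra `A`, `∂ᵢ ∂ⱼ = ∂ⱼ ∂ᵢ` and `∂ᵢ a = a ∂ᵢ + ∂ᵢ(a)`. -/
inductive DiffOp.Rel (d : Partials n A) :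
    FreeAlgebra ℂ (A ⊕ Fin n) → FreeAlgebra ℂ (A ⊕ Fin n) → Prop
  | add (a b : A) : Rel d (.ι ℂ (.inl (a + b))) (.ι ℂ (.inl a) + .ι ℂ (.inl b))
  | mul (a b : A) : Rel d (.ι ℂ (.inl (a * b))) (.ι ℂ (.inl a) * .ι ℂ (.inl b))
  | scalar (c : ℂ) : Rel d (.ι ℂ (.inl (algebraMap ℂ A c))) (algebraMap ℂ _ c)
  | comm (i j : Fin n) :
      Rel d (.ι ℂ (.inr i) * .ι ℂ (.inr j)) (.ι ℂ (.inr j) * .ι ℂ (.inr i))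
  | leibniz (i : Fin n) (a : A) :
      Rel d (.ι ℂ (.inr i) * .ι ℂ (.inl a))
        (.ι ℂ (.inl a) * .ι ℂ (.inr i) + .ι ℂ (.inl (d.der i a)))

/-- The ring `A⟨∂₁, …, ∂ₙ⟩` of differential operators with coefficients in `A`. For the
polynomial ring this is the Weyl algebra, for the local ring of `ℂⁿ` at a point it is the stalk
of the sheaf of differential operators. -/
def DiffOp (d : Partials n A) : Type _ := RingQuot (DiffOp.Rel d)

instance (d : Partials n A) : Ring (DiffOp d) := inferInstanceAs (Ring (RingQuot _))

instance (d : Partials n A) : Algebra ℂ (DiffOp d) := inferInstanceAs (Algebra ℂ (RingQuot _))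

/-- The quotient map from the free algebra onto the ring of differential operators. -/
def DiffOp.mk (d : Partials n A) : FreeAlgebra ℂ (A ⊕ Fin n) →ₐ[ℂ] DiffOp d :=
  RingQuot.mkAlgHom ℂ (DiffOp.Rel d)

theorem DiffOp.mk_surjective (d : Partials n A) : Function.Surjective (DiffOp.mk d) :=
  RingQuot.mkAlgHom_surjective ℂ (DiffOp.Rel d)

/-! ### The module `A_f[s] f^s` -/

/-- The module `A_f[s] f^s`: an element `g ∈ A_f[s]` stands for the symbol `g f^s`. -/
def PowModule (_d : Partials n A) (f : A) : Type _ := (Localization.Away f)[X]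

instance (d : Partials n A) (f : A) : AddCommGroup (PowModule d f) :=
  inferInstanceAs (AddCommGroup (Localization.Away f)[X])

instance (d : Partials n A) (f : A) : Module ℂ (PowModule d f) :=
  inferInstanceAs (Module ℂ (Localization.Away f)[X])

/-- The element `g f^s` of `A_f[s] f^s`. -/
def PowModule.mk (d : Partials n A) (f : A) : (Localization.Away f)[X] ≃ₗ[ℂ] PowModule d f :=
  LinearEquiv.refl ℂ _

/-- Multiplication by an element of `A_f[s]` on `A_f[s] f^s`. -/
def PowModule.mulBy (d : Partials n A) (f : A) :
    (Localization.Away f)[X] →ₐ[ℂ] Module.End ℂ (PowModule d f) :=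
  Algebra.lmul ℂ (Localization.Away f)[X]

/-- The logarithmic derivative `∂ᵢ(f) / f ∈ A_f`. -/
def logDer (d : Partials n A) (f : A) (i : Fin n) : Localization.Away f :=
  algebraMap A _ (d.der i f) * IsLocalization.Away.invSelf f

/-- The partial derivative on `A_f[s] f^s`:
`∂ᵢ (g f^s) = (∂ᵢ(g) + s g ∂ᵢ(f) / f) f^s`. -/
def PowModule.pd (d : Partials n A) (f : A) (i : Fin n) : Module.End ℂ (PowModule d f) :=
  ((coeffDer (extendDer (Submonoid.powers f) (Localization.Away f) (d.der i))).toLinearMap :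
    Module.End ℂ (Localization.Away f)[X]) +
  Algebra.lmul ℂ (Localization.Away f)[X] (Polynomial.X * Polynomial.C (logDer d f i))

theorem PowModule.pd_mk (d : Partials n A) (f : A) (i : Fin n)
    (g : (Localization.Away f)[X]) :
    PowModule.pd d f i (PowModule.mk d f g) = PowModule.mk d f
      (coeffDer (extendDer (Submonoid.powers f) (Localization.Away f) (d.der i)) g
        + Polynomial.X * Polynomial.C (logDer d f i) * g) := rfl

theorem PowModule.mulBy_mk (d : Partials n A) (f : A) (h g : (Localization.Away f)[X]) :
    PowModule.mulBy d f h (PowModule.mk d f g) = PowModule.mk d f (h * g) := rfl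

theorem coeffDer_C (δ : Derivation ℂ A A) (a : A) :
    coeffDer δ (Polynomial.C a) = Polynomial.C (δ a) := by
  ext k
  rw [coeff_coeffDer, Polynomial.coeff_C, Polynomial.coeff_C]
  split_ifs <;> simp

theorem coeffDer_X (δ : Derivation ℂ A A) : coeffDer δ (Polynomial.X : A[X]) = 0 := by
  ext k
  rw [coeff_coeffDer, Polynomial.coeff_X]
  split_ifs <;> simp

theorem coeffDer_comm {δ ε : Derivation ℂ A A} (h : ∀ a, δ (ε a) = ε (δ a)) (p : A[X]) :
    coeffDer δ (coeffDer ε p) = coeffDer ε (coeffDer δ p) := by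
  ext k
  simp only [coeff_coeffDer, h]

theorem extendDer_logDer (d : Partials n A) (f : A) (i j : Fin n) :
    extendDer (Submonoid.powers f) (Localization.Away f) (d.der i) (logDer d f j) =
      extendDer (Submonoid.powers f) (Localization.Away f) (d.der j) (logDer d f i) := by
  set F := algebraMap A (Localization.Away f) f with hF
  set u := IsLocalization.Away.invSelf (S := Localization.Away f) f with hu
  have h1 : F * u = 1 := IsLocalization.Away.mul_invSelf f
  have key : ∀ k : Fin n, extendDer (Submonoid.powers f) (Localization.Away f) (d.der k) u
      = - (u * u * algebraMap A (Localization.Away f) (d.der k f)) := by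
    intro k
    have h2 := congrArg (extendDer (Submonoid.powers f) (Localization.Away f) (d.der k)) h1
    rw [Derivation.leibniz, Derivation.map_one_eq_zero, hF, extendDer_algebraMap, ← hF] at h2
    simp only [smul_eq_mul] at h2
    linear_combination u * h2 -
      (extendDer (Submonoid.powers f) (Localization.Away f) (d.der k) u) * h1
  simp only [logDer, ← hu, Derivation.leibniz, smul_eq_mul, extendDer_algebraMap, key,
    d.comm i j f]
  ring

theorem twisted_comm {R : Type*} [CommRing R] [Algebra ℂ R] (D E : Derivation ℂ R R) (u v g : R)
    (h : D (E g) = E (D g)) (huv : D v = E u) :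
    D (E g + v * g) + u * (E g + v * g) = E (D g + u * g) + v * (D g + u * g) := by
  simp only [map_add, Derivation.leibniz, smul_eq_mul, h, huv]
  ring

theorem PowModule.pd_comm (d : Partials n A) (f : A) (i j : Fin n) :
    PowModule.pd d f i * PowModule.pd d f j =
      PowModule.pd d f j * PowModule.pd d f i := by
  apply LinearMap.ext
  intro x
  obtain ⟨g, rfl⟩ := (PowModule.mk d f).surjective x
  rw [Module.End.mul_apply, Module.End.mul_apply, PowModule.pd_mk, PowModule.pd_mk,
    PowModule.pd_mk, PowModule.pd_mk]
  refine congrArg (PowModule.mk d f) (twisted_comm _ _ _ _ _ ?_ ?_)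
  · exact coeffDer_comm
      (extendDer_comm (Submonoid.powers f) (Localization.Away f) (d.comm i j)) g
  · rw [Derivation.leibniz, Derivation.leibniz, coeffDer_X, coeffDer_X, coeffDer_C, coeffDer_C,
      extendDer_logDer d f i j, smul_zero, smul_zero]

/-- The action of differential operators on `A_f[s] f^s`. -/
def DiffOp.act (d : Partials n A) (f : A) : DiffOp d →ₐ[ℂ] Module.End ℂ (PowModule d f) :=
  RingQuot.liftAlgHom ℂ ⟨FreeAlgebra.lift ℂ (Sum.elim
      (fun a => PowModule.mulBy d f (Polynomial.C (algebraMap A _ a)))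
      (PowModule.pd d f)), by
    intro x y h
    cases h with
    | add a b => simp
    | mul a b => simp
    | scalar c =>
      simp only [FreeAlgebra.lift_ι_apply, Sum.elim_inl, AlgHom.commutes,
        ← IsScalarTower.algebraMap_apply ℂ A (Localization.Away f)]
      exact (PowModule.mulBy d f).commutes c
    | comm i j => simpa using PowModule.pd_comm d f i j
    | leibniz i a =>
      simp only [map_mul, map_add, FreeAlgebra.lift_ι_apply, Sum.elim_inl, Sum.elim_inr]
      apply LinearMap.ext
      intro x
      obtain ⟨g, rfl⟩ := (PowModule.mk d f).surjective x
      simp only [Module.End.mul_apply, LinearMap.add_apply, PowModule.pd_mk,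
        PowModule.mulBy_mk, ← map_add]
      congr 1
      simp only [Derivation.leibniz, smul_eq_mul, coeffDer_C, extendDer_algebraMap]
      ring⟩

theorem DiffOp.act_mk_ι (d : Partials n A) (f : A) (x : A ⊕ Fin n) :
    DiffOp.act d f (DiffOp.mk d (FreeAlgebra.ι ℂ x)) =
      Sum.elim (fun a => PowModule.mulBy d f (Polynomial.C (algebraMap A _ a)))
        (PowModule.pd d f) x :=
  (RingQuot.liftAlgHom_mkAlgHom_apply ℂ _ _ _).trans (FreeAlgebra.lift_ι_apply _ _)

theorem PowModule.commute_s (d : Partials n A) (f : A) (P : DiffOp d) :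
    Commute (DiffOp.act d f P) (PowModule.mulBy d f Polynomial.X) := by
  obtain ⟨w, rfl⟩ := DiffOp.mk_surjective d P
  induction w using FreeAlgebra.induction with
  | grade0 c =>
    rw [AlgHom.commutes, AlgHom.commutes]
    exact Algebra.commutes _ _
  | grade1 x =>
    rw [DiffOp.act_mk_ι]
    rcases x with a | i
    · exact (Commute.all _ _).map (PowModule.mulBy d f)
    · apply LinearMap.ext
      intro x
      obtain ⟨g, rfl⟩ := (PowModule.mk d f).surjective x
      simp only [Sum.elim_inr, Module.End.mul_apply, PowModule.pd_mk, PowModule.mulBy_mk]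
      congr 1
      simp only [Derivation.leibniz, smul_eq_mul, coeffDer_X]
      ring
  | mul a b ha hb =>
    rw [map_mul, map_mul]
    exact ha.mul_left hb
  | add a b ha hb =>
    rw [map_add, map_add]
    exact ha.add_left hb

/-- The action of `D[s]` on `A_f[s] f^s`: the variable `s` acts as multiplication by `s`. -/
def DiffOp.actS (d : Partials n A) (f : A) : (DiffOp d)[X] →+* Module.End ℂ (PowModule d f) :=
  Polynomial.eval₂RingHom' (DiffOp.act d f).toRingHom (PowModule.mulBy d f Polynomial.X)
    (PowModule.commute_s d f)

instance (d : Partials n A) (f : A) : Module (DiffOp d)[X] (PowModule d f) :=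
  Module.compHom (PowModule d f) (DiffOp.actS d f)

theorem DiffOp.smul_def (d : Partials n A) (f : A) (P : (DiffOp d)[X]) (x : PowModule d f) :
    P • x = DiffOp.actS d f P x := rfl

theorem DiffOp.C_smul (d : Partials n A) (f : A) (P : DiffOp d) (x : PowModule d f) :
    (Polynomial.C P : (DiffOp d)[X]) • x = DiffOp.act d f P x :=
  congrArg (fun T : Module.End ℂ (PowModule d f) => T x) (Polynomial.eval₂_C _ _)

theorem DiffOp.X_smul (d : Partials n A) (f : A) (x : PowModule d f) :
    (Polynomial.X : (DiffOp d)[X]) • x = PowModule.mulBy d f Polynomial.X x :=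
  congrArg (fun T : Module.End ℂ (PowModule d f) => T x) (Polynomial.eval₂_X _ _)

instance (d : Partials n A) (f : A) : IsScalarTower ℂ (DiffOp d)[X] (PowModule d f) where
  smul_assoc c P x := by
    rw [DiffOp.smul_def, DiffOp.smul_def, Algebra.smul_def, map_mul, Module.End.mul_apply]
    have : DiffOp.actS d f (algebraMap ℂ (DiffOp d)[X] c) = algebraMap ℂ _ c := by
      rw [Polynomial.algebraMap_apply]
      simp [DiffOp.actS]
    rw [this, Module.algebraMap_end_apply]

/-! ### Bernstein-Sato polynomials -/

/-- The module `D[s] f^s`. -/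
def powSpan (d : Partials n A) (f : A) : Submodule (DiffOp d)[X] (PowModule d f) :=
  Submodule.span _ {PowModule.mk d f 1}

/-- The module `D[s] f^(s+1)`, where `f^(s+1) = f · f^s`. -/
def powSuccSpan (d : Partials n A) (f : A) : Submodule (DiffOp d)[X] (PowModule d f) :=
  Submodule.span _ {PowModule.mk d f (Polynomial.C (algebraMap A _ f))}

/-- The quotient `D[s] f^s / D[s] f^(s+1)`. -/
abbrev BSModule (d : Partials n A) (f : A) : Type _ :=
  powSpan d f ⧸ (powSuccSpan d f).submoduleOf (powSpan d f)

/-- The Bernstein-Sato polynomial of `f ∈ A` with respect to the ring `D = A⟨∂₁, …, ∂ₙ⟩`: the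
minimal polynomial of `s` acting on `D[s] f^s / D[s] f^(s+1)`. -/
def bernsteinSato (d : Partials n A) (f : A) : ℂ[X] :=
  minpoly ℂ (Algebra.lsmul ℂ ℂ (BSModule d f) (Polynomial.X : (DiffOp d)[X]))

end DiffOp

/-- The usual partial derivatives on `ℂ[x₁, …, xₙ]`. -/
def stdPartials (n : ℕ) : Partials n (MvPolynomial (Fin n) ℂ) where
  der i := MvPolynomial.pderiv i
  comm i j a := by
    have : ⁅(MvPolynomial.pderiv i :
          Derivation ℂ (MvPolynomial (Fin n) ℂ) (MvPolynomial (Fin n) ℂ)),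
        (MvPolynomial.pderiv j :
          Derivation ℂ (MvPolynomial (Fin n) ℂ) (MvPolynomial (Fin n) ℂ))⁆ = 0 := by
      refine MvPolynomial.derivation_ext fun k => ?_
      simp [Derivation.commutator_apply, MvPolynomial.pderiv_X, Pi.single_apply, apply_ite]
    have h2 := congrArg (fun D => D a) this
    simpa [Derivation.commutator_apply, sub_eq_zero] using h2

/-- The (global) `b`-function of a polynomial. -/
def bFunction {n : ℕ} (f : MvPolynomial (Fin n) ℂ) : ℂ[X] :=
  bernsteinSato (stdPartials n) f

/-- The maximal ideal of the polynomials vanishing at `q`. -/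
def pointIdeal {n : ℕ} (q : Fin n → ℂ) : Ideal (MvPolynomial (Fin n) ℂ) :=
  RingHom.ker (MvPolynomial.eval q)

instance {n : ℕ} (q : Fin n → ℂ) : (pointIdeal q).IsPrime :=
  RingHom.ker_isPrime (MvPolynomial.eval q)

/-- The local ring of `ℂⁿ` at `q`. -/
abbrev LocalRingAt {n : ℕ} (q : Fin n → ℂ) : Type := Localization.AtPrime (pointIdeal q)

/-- The partial derivatives on the local ring of `ℂⁿ` at `q`. -/
def localPartials {n : ℕ} (q : Fin n → ℂ) : Partials n (LocalRingAt q) :=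
  (stdPartials n).localize (pointIdeal q).primeCompl (LocalRingAt q)

/-- The local `b`-function of a polynomial at `q`, defined as the `b`-function with the ring of
differential operators replaced by its stalk at `q`. -/
def localBFunction {n : ℕ} (f : MvPolynomial (Fin n) ℂ) (q : Fin n → ℂ) : ℂ[X] :=
  bernsteinSato (localPartials q) (algebraMap (MvPolynomial (Fin n) ℂ) (LocalRingAt q) f)

/-! ### Vandermonde determinants -/

/-- `ξ_S = ∏ (xᵢ - xⱼ)` over the pairs `i < j` in `S`. -/
def vandermondeOn {n : ℕ} (S : Finset (Fin n)) : MvPolynomial (Fin n) ℂ :=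
  ∏ p ∈ (S ×ˢ S).filter (fun p => p.1 < p.2), (MvPolynomial.X p.1 - MvPolynomial.X p.2)

/-- `ξ_n = ∏ (xᵢ - xⱼ)` over all `i < j`. -/
def vandermonde (n : ℕ) : MvPolynomial (Fin n) ℂ := vandermondeOn Finset.univ

/-- `ξ_P`, the product of `ξ_S` over the blocks `S` of a set partition `P`. -/
def vandermondePartition {n : ℕ} (P : Finpartition (Finset.univ : Finset (Fin n))) :
    MvPolynomial (Fin n) ℂ :=
  ∏ S ∈ P.parts, vandermondeOn S

end BernsteinSato

end

noncomputable section

namespace BernsteinSato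

/-! Write `ξ_n = v g`, where `g` collects the factors `x_i - x_j` with `q_i = q_j` and `v` the
others. Then `g = ξ_P` and `v(q) ≠ 0`, so `v` is a unit in the local ring. For such a `g` the local
b-function of `v g` at `q` equals the global one of `g` (`localBFunction_mul_eq_bFunction`).

A b-function is determined by the set of `p` with `p(s) f^s ∈ D[s] f^(s+1)`, so it is enough to
compare these sets. Passing from `g` to `v g` in the local ring preserves membership, because
conjugation by `v^s` only changes `∂_i` by `s v⁻¹ ∂_i(v)` (`isBernsteinPolynomial_localize`).
Conversely, clearing denominators in a local relation gives `h p(s) g^s ∈ D[s] g^(s+1)` over the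
polynomial ring, for some `h` with `h(q) ≠ 0` (`exists_mul_mem_powSuccSpan`).

To remove `h`, use the Euler field `E = ∑ (x_i - q_i) ∂_i`. Each factor of `g` is an eigenvector of
`E`, hence so is `g`: `E(g) = c g`. Applying `E` to `h p(s) g^s` gives `(E(h) + c s h) p(s) g^s`, so
the ideal of all such multipliers `h` is stable under `E` (`eulerAt_mem_multiplierIdeal`). An
`E`-stable ideal not contained in the maximal ideal of `q` contains 1: the operators `E - k` with `k
> 0` lower the degree of `h` step by step and only scale `h(q)` by `-k`
(`eq_top_of_eulerAt_stable`). -/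

/-! ### Minimal polynomials and annihilators of cyclic quotients -/

/-- If no monic polynomial annihilates, both sides take the default value 0, so the existence of
b-functions is never needed. -/
theorem minpoly_eq_of_aeval_eq_zero_iff {k R S : Type*} [Field k] [Ring R] [Ring S] [Algebra k R]
    [Algebra k S] (x : R) (y : S)
    (h : ∀ p : k[X], Polynomial.aeval x p = 0 ↔ Polynomial.aeval y p = 0) :
    minpoly k x = minpoly k y := by
  by_cases hx : IsIntegral k x
  · have hy : IsIntegral k y := by
      obtain ⟨p, hp, hp0⟩ := hx
      exact ⟨p, hp, (h p).1 hp0⟩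
    refine minpoly.unique k y (minpoly.monic hx) ((h _).1 (minpoly.aeval k x)) fun p hp hp0 => ?_
    exact minpoly.min k x hp ((h p).2 hp0)
  · have hy : ¬ IsIntegral k y := by
      rintro ⟨p, hp, hp0⟩
      exact hx ⟨p, hp, (h p).2 hp0⟩
    rw [minpoly.eq_zero hx, minpoly.eq_zero hy]

/-- Since `c` is central, it kills a cyclic module as soon as it kills the generator. -/
theorem lsmul_quotient_eq_zero_iff {k R M : Type*} [Field k] [Ring R] [Algebra k R]
    [AddCommGroup M] [Module R M] [Module k M] [IsScalarTower k R M] (v : M) (N : Submodule R M)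
    (c : R) (hc : ∀ r, Commute c r) :
    Algebra.lsmul k k
      (Submodule.span R {v} ⧸ N.submoduleOf (Submodule.span R {v})) c = 0 ↔ c • v ∈ N := by
  constructor
  · intro h
    have h2 := LinearMap.congr_fun h (Submodule.Quotient.mk
      ⟨v, Submodule.mem_span_singleton_self _⟩)
    rw [Algebra.lsmul_coe, LinearMap.zero_apply] at h2
    beta_reduce at h2
    rwa [← Submodule.Quotient.mk_smul,
      Submodule.Quotient.mk_eq_zero, Submodule.submoduleOf,
      Submodule.mem_comap, Submodule.subtype_apply] at h2
  · intro h
    refine LinearMap.ext fun x => ?_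
    obtain ⟨⟨x, hx⟩, rfl⟩ := Submodule.Quotient.mk_surjective _ x
    obtain ⟨r, rfl⟩ := Submodule.mem_span_singleton.1 hx
    rw [Algebra.lsmul_coe, LinearMap.zero_apply]
    beta_reduce
    rw [← Submodule.Quotient.mk_smul,
      Submodule.Quotient.mk_eq_zero, Submodule.submoduleOf,
      Submodule.mem_comap, Submodule.subtype_apply]
    change c • r • v ∈ N
    rw [← mul_smul, (hc r).eq, mul_smul]
    exact N.smul_mem r h

/-! ### Bernstein relations `p(s) f^s ∈ D[s] f^(s+1)` -/

section General

variable {n : ℕ} {A : Type*} [CommRing A] [Algebra ℂ A] (d : Partials n A) (f : A)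

theorem C_mul_mem {N : Submodule (DiffOp d)[X] (PowModule d f)} {y : (Localization.Away f)[X]}
    (a : A) (hy : PowModule.mk d f y ∈ N) :
    PowModule.mk d f (Polynomial.C (algebraMap A _ a) * y) ∈ N := by
  have h := N.smul_mem (Polynomial.C (DiffOp.mk d (FreeAlgebra.ι ℂ (Sum.inl a)))) hy
  rwa [DiffOp.C_smul, DiffOp.act_mk_ι] at h

theorem X_mul_mem {N : Submodule (DiffOp d)[X] (PowModule d f)} {y : (Localization.Away f)[X]}
    (hy : PowModule.mk d f y ∈ N) : PowModule.mk d f (Polynomial.X * y) ∈ N := by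
  have h := N.smul_mem Polynomial.X hy
  rwa [DiffOp.X_smul] at h

theorem pd_mem {N : Submodule (DiffOp d)[X] (PowModule d f)} {y : PowModule d f}
    (i : Fin n) (hy : y ∈ N) : PowModule.pd d f i y ∈ N := by
  have h := N.smul_mem (Polynomial.C (DiffOp.mk d (FreeAlgebra.ι ℂ (Sum.inr i)))) hy
  rwa [DiffOp.C_smul, DiffOp.act_mk_ι] at h

/-- An additive subgroup stable under `A`, `s` and the partial derivatives is stable
under `D[s]`. -/
theorem smul_mem_of_stable (K : AddSubgroup (PowModule d f))
    (hC : ∀ (a : A) (y), PowModule.mk d f y ∈ K →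
      PowModule.mk d f (Polynomial.C (algebraMap A _ a) * y) ∈ K)
    (hX : ∀ y, PowModule.mk d f y ∈ K → PowModule.mk d f (Polynomial.X * y) ∈ K)
    (hpd : ∀ (i : Fin n) (y), PowModule.mk d f y ∈ K →
      PowModule.pd d f i (PowModule.mk d f y) ∈ K)
    (r : (DiffOp d)[X]) (y : PowModule d f) (hy : y ∈ K) : r • y ∈ K := by
  induction r using Polynomial.induction_on' generalizing y with
  | add p q hp hq => rw [add_smul]; exact K.add_mem (hp y hy) (hq y hy)
  | monomial k P =>
    rw [← Polynomial.C_mul_X_pow_eq_monomial, mul_smul]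
    have hXk : (Polynomial.X ^ k : (DiffOp d)[X]) • y ∈ K := by
      induction k with
      | zero => simpa using hy
      | succ k ih =>
        rw [pow_succ', mul_smul, DiffOp.X_smul]
        exact hX _ ih
    generalize (Polynomial.X ^ k : (DiffOp d)[X]) • y = z at hXk
    rw [DiffOp.C_smul]
    obtain ⟨w, rfl⟩ := DiffOp.mk_surjective d P
    induction w using FreeAlgebra.induction generalizing z with
    | grade0 c =>
      obtain ⟨g, rfl⟩ := (PowModule.mk d f).surjective z
      have := hC (algebraMap ℂ A c) g hXk
      rw [← IsScalarTower.algebraMap_apply ℂ A (Localization.Away f)] at this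
      rw [AlgHom.commutes, AlgHom.commutes, Module.algebraMap_end_apply, ← map_smul,
        Algebra.smul_def]
      exact this
    | grade1 x =>
      rw [DiffOp.act_mk_ι]
      rcases x with a | i
      · exact hC a z hXk
      · exact hpd i z hXk
    | mul a b ha hb =>
      rw [map_mul, map_mul, Module.End.mul_apply]
      exact ha _ (hb _ hXk)
    | add a b ha hb =>
      rw [map_add, map_add, LinearMap.add_apply]
      exact K.add_mem (ha _ hXk) (hb _ hXk)

/-- Only an additive subgroup is asked for, so that `K` can be a preimage under the map `symbolMap`,
which is not `D`-linear, or a set defined by clearing denominators. -/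
theorem powSuccSpan_le_of_stable (K : AddSubgroup (PowModule d f))
    (hf : PowModule.mk d f (Polynomial.C (algebraMap A _ f)) ∈ K)
    (hC : ∀ (a : A) (y), PowModule.mk d f y ∈ K →
      PowModule.mk d f (Polynomial.C (algebraMap A _ a) * y) ∈ K)
    (hX : ∀ y, PowModule.mk d f y ∈ K → PowModule.mk d f (Polynomial.X * y) ∈ K)
    (hpd : ∀ (i : Fin n) (y), PowModule.mk d f y ∈ K →
      PowModule.pd d f i (PowModule.mk d f y) ∈ K)
    {y : PowModule d f} (hy : y ∈ powSuccSpan d f) : y ∈ K := by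
  induction hy using Submodule.span_induction with
  | mem x hx => rw [Set.mem_singleton_iff.1 hx]; exact hf
  | zero => exact K.zero_mem
  | add x y _ _ hx hy => exact K.add_mem hx hy
  | smul r x _ hx => exact smul_mem_of_stable d f K hC hX hpd r x hx

/-- `p(s) f^s ∈ D[s] f^(s+1)`. -/
def IsBernsteinPolynomial (p : ℂ[X]) : Prop :=
  PowModule.mk d f (p.map (algebraMap ℂ (Localization.Away f))) ∈ powSuccSpan d f

theorem aeval_X_smul (p : ℂ[X]) (y : (Localization.Away f)[X]) :
    (Polynomial.aeval (Polynomial.X : (DiffOp d)[X]) p) • PowModule.mk d f y =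
      PowModule.mk d f (p.map (algebraMap ℂ (Localization.Away f)) * y) := by
  induction p using Polynomial.induction_on' with
  | add p q hp hq => rw [map_add, add_smul, hp, hq, Polynomial.map_add, add_mul, map_add]
  | monomial k c =>
    rw [Polynomial.aeval_monomial, Polynomial.map_monomial]
    induction k with
    | zero =>
      rw [pow_zero, mul_one, algebraMap_smul, Polynomial.monomial_zero_left, ← map_smul,
        Algebra.smul_def]
      rfl
    | succ k ih =>
      rw [pow_succ', (Polynomial.commute_X _).symm.left_comm, mul_smul, ih, DiffOp.X_smul,
        PowModule.mulBy_mk, Polynomial.X_mul, mul_right_comm, Polynomial.monomial_mul_X]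

theorem aeval_lsmul_eq_zero_iff (p : ℂ[X]) :
    Polynomial.aeval (Algebra.lsmul ℂ ℂ (BSModule d f) (Polynomial.X : (DiffOp d)[X])) p = 0 ↔
      IsBernsteinPolynomial d f p := by
  have h1 := aeval_X_smul d f p 1
  rw [mul_one] at h1
  rw [Polynomial.aeval_algHom_apply, IsBernsteinPolynomial, ← h1]
  refine lsmul_quotient_eq_zero_iff (k := ℂ) (PowModule.mk d f 1) (powSuccSpan d f) _ fun r => ?_
  induction p using Polynomial.induction_on' with
  | add a b ha hb =>
    rw [map_add]
    exact (ha (aeval_X_smul d f a 1 |>.trans (by rw [mul_one]))).add_left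
      (hb (aeval_X_smul d f b 1 |>.trans (by rw [mul_one])))
  | monomial k c =>
    rw [Polynomial.aeval_monomial]
    exact Commute.mul_left (Algebra.commutes c r) ((Polynomial.commute_X r).pow_left k)

end General

theorem bernsteinSato_congr {n m : ℕ} {A B : Type*} [CommRing A] [Algebra ℂ A] [CommRing B]
    [Algebra ℂ B] {d : Partials n A} {e : Partials m B} {f : A} {g : B}
    (h : ∀ p, IsBernsteinPolynomial d f p ↔ IsBernsteinPolynomial e g p) :
    bernsteinSato d f = bernsteinSato e g :=
  minpoly_eq_of_aeval_eq_zero_iff _ _ fun p => by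
    rw [aeval_lsmul_eq_zero_iff, aeval_lsmul_eq_zero_iff, h]

/-! ### Localization, multiplication by a unit, and clearing denominators -/

theorem isUnit_algebraMap_away {A B : Type*} [CommRing A] [CommRing B] [Algebra A B] (g : A)
    (u : Bˣ) :
    IsUnit (((algebraMap B (Localization.Away (u * algebraMap A B g))).comp
      (algebraMap A B)) g) :=
  isUnit_of_mul_isUnit_right (x := algebraMap B _ (u : B)) <| by
    rw [RingHom.comp_apply, ← map_mul]
    exact IsLocalization.Away.algebraMap_isUnit _

/-- The map `A_g → B_{ug}` for a unit `u` of an `A`-algebra `B`. -/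
def awayMap {A B : Type*} [CommRing A] [CommRing B] [Algebra A B] (g : A)
    (u : Bˣ) :
    Localization.Away g →+* Localization.Away ((u : B) * algebraMap A B g) :=
  IsLocalization.Away.lift g (isUnit_algebraMap_away g u)

theorem awayMap_algebraMap {A B : Type*} [CommRing A] [CommRing B] [Algebra A B] (g : A)
    (u : Bˣ) (a : A) :
    awayMap g u (algebraMap A _ a) = algebraMap B _ (algebraMap A B a) :=
  IsLocalization.Away.lift_eq g (isUnit_algebraMap_away g u) a

theorem awayMap_injective {A B : Type*} [CommRing A] [CommRing B] [Algebra A B] (M : Submonoid A)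
    [IsLocalization M B] (g : A) (u : Bˣ) [IsDomain A]
    (hM : M ≤ nonZeroDivisors A) (hg : g ≠ 0) :
    Function.Injective (awayMap (B := B) g u) := by
  have hAB : Function.Injective (algebraMap A B) := IsLocalization.injective B hM
  have : IsDomain B := IsLocalization.isDomain_of_le_nonZeroDivisors B hM
  have hF : (u : B) * algebraMap A B g ≠ 0 :=
    mul_ne_zero u.ne_zero ((map_ne_zero_iff _ hAB).2 hg)
  have hB : Function.Injective (algebraMap B (Localization.Away ((u : B) * algebraMap A B g))) :=
    IsLocalization.injective _ (powers_le_nonZeroDivisors_of_noZeroDivisors hF)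
  refine (IsLocalization.lift_injective_iff _).2 fun a b => ?_
  rw [RingHom.comp_apply, RingHom.comp_apply, hB.eq_iff, hAB.eq_iff,
    (IsLocalization.injective (Localization.Away g)
      (powers_le_nonZeroDivisors_of_noZeroDivisors hg)).eq_iff]

section Transfer

variable {n : ℕ} {A B : Type*} [CommRing A] [Algebra ℂ A] [CommRing B] [Algebra ℂ B]
  [Algebra A B] [IsScalarTower ℂ A B] (M : Submonoid A) [IsLocalization M B] (d : Partials n A)
  (g : A) (u : Bˣ)

theorem awayMap_comp_algebraMap :
    (awayMap g u).comp (algebraMap ℂ (Localization.Away g)) =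
      algebraMap ℂ (Localization.Away ((u : B) * algebraMap A B g)) := by
  ext c
  rw [RingHom.comp_apply, IsScalarTower.algebraMap_apply ℂ A (Localization.Away g),
    awayMap_algebraMap, ← IsScalarTower.algebraMap_apply ℂ A B,
    ← IsScalarTower.algebraMap_apply ℂ B]

/-- A derivation extends uniquely to fractions: both sides satisfy the equation obtained by
differentiating `x m = a`, and the image of `m` is a unit. -/
theorem awayMap_extendDer (δ : Derivation ℂ A A) (x : Localization.Away g) :
    awayMap g u (extendDer (Submonoid.powers g) _ δ x) =
      extendDer (Submonoid.powers ((u : B) * algebraMap A B g)) _ (extendDer M B δ)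
        (awayMap g u x) := by
  obtain ⟨⟨a, m⟩, hm⟩ := IsLocalization.surj (Submonoid.powers g) x
  have hu : IsUnit (awayMap g u (algebraMap A _ (m : A))) :=
    (IsLocalization.map_units (Localization.Away g) m).map (awayMap g u)
  have h1 := congrArg (fun y => awayMap g u (extendDer (Submonoid.powers g) _ δ y)) hm
  have h2 := congrArg (fun y => extendDer (Submonoid.powers ((u : B) * algebraMap A B g)) _
    (extendDer M B δ) (awayMap g u y)) hm
  simp only [map_mul, Derivation.leibniz, smul_eq_mul, map_add, extendDer_algebraMap,
    awayMap_algebraMap] at h1 h2 hu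
  rw [← hu.mul_right_inj]
  linear_combination h1 - h2

/-- Logarithmic derivatives turn the product `u g` into a sum. -/
theorem logDer_localize (i : Fin n) :
    logDer (d.localize M B) ((u : B) * algebraMap A B g) i = awayMap g u (logDer d g i) +
      algebraMap B _ ((u⁻¹ : Bˣ) * (d.localize M B).der i u) := by
  have hF := IsLocalization.Away.algebraMap_isUnit
    (S := Localization.Away ((u : B) * algebraMap A B g))
    ((u : B) * algebraMap A B g)
  have h1 := IsLocalization.Away.mul_invSelf (S := Localization.Away ((u : B) * algebraMap A B g))
    ((u : B) * algebraMap A B g)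
  have h2 := congrArg (awayMap g u) (IsLocalization.Away.mul_invSelf (S := Localization.Away _) g)
  have h3 : (d.localize M B).der i ((u : B) * algebraMap A B g) =
      u * algebraMap A B (d.der i g) + algebraMap A B g * (d.localize M B).der i u := by
    rw [Derivation.leibniz]
    change _ • extendDer M B (d.der i) _ + _ = _
    rw [extendDer_algebraMap, smul_eq_mul, smul_eq_mul]
  have h4 := congrArg (algebraMap B (Localization.Away ((u : B) * algebraMap A B g)))
    u.mul_inv
  rw [← hF.mul_right_inj]
  simp only [logDer, h3, map_mul, map_add, map_one, awayMap_algebraMap] at h1 h2 h4 ⊢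
  set v := algebraMap B (Localization.Away ((u : B) * algebraMap A B g)) (u : B)
  set G := algebraMap B (Localization.Away ((u : B) * algebraMap A B g)) (algebraMap A B g)
  set dG := algebraMap B (Localization.Away ((u : B) * algebraMap A B g))
    (algebraMap A B (d.der i g))
  set du := algebraMap B (Localization.Away ((u : B) * algebraMap A B g))
    ((d.localize M B).der i u)
  linear_combination (v * dG + G * du) * h1 - v * dG * h2 - G * du * h4

theorem map_coeffDer (δ : Derivation ℂ A A) (y : (Localization.Away g)[X]) :
    (coeffDer (extendDer (Submonoid.powers g) _ δ) y).map (awayMap g u) =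
      coeffDer (extendDer (Submonoid.powers ((u : B) * algebraMap A B g)) _ (extendDer M B δ))
        (y.map (awayMap g u)) := by
  ext k
  rw [Polynomial.coeff_map, coeff_coeffDer, coeff_coeffDer, Polynomial.coeff_map,
    awayMap_extendDer M]

/-- The map `A_g[s] g^s → B_{ug}[s] (ug)^s` on the symbols. -/
def symbolMap : PowModule d g →+ PowModule (d.localize M B) ((u : B) * algebraMap A B g) :=
  (Polynomial.mapRingHom (awayMap g u)).toAddMonoidHom

theorem symbolMap_mk (y : (Localization.Away g)[X]) :
    symbolMap M d g u (PowModule.mk d g y) = PowModule.mk _ _ (y.map (awayMap g u)) := rfl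

/-- On symbols the factor `u^s` is forgotten; differentiating it produces the correction `s u⁻¹
∂_i(u)`. The correction is itself an operator in `D[s]`, so it does no harm to membership in
submodules. -/
theorem pd_symbolMap (i : Fin n) (y : (Localization.Away g)[X]) :
    PowModule.pd (d.localize M B) ((u : B) * algebraMap A B g) i
      (symbolMap M d g u (PowModule.mk d g y)) =
    symbolMap M d g u (PowModule.pd d g i (PowModule.mk d g y)) +
      PowModule.mk _ _ (Polynomial.C (algebraMap B _ ((u⁻¹ : Bˣ) * (d.localize M B).der i u)) *
        (Polynomial.X * y.map (awayMap g u))) := by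
  have hder : (d.localize M B).der i = extendDer M B (d.der i) := rfl
  rw [symbolMap_mk, PowModule.pd_mk, PowModule.pd_mk, symbolMap_mk, ← map_add,
    Polynomial.map_add, map_coeffDer M, logDer_localize M d g u i]
  congr 1
  rw [Polynomial.map_mul, Polynomial.map_mul, Polynomial.map_X, Polynomial.map_C,
    Polynomial.C_add, hder]
  ring

theorem symbolMap_mem {x : PowModule d g} (hx : x ∈ powSuccSpan d g) :
    symbolMap M d g u x ∈
      powSuccSpan (d.localize M B) ((u : B) * algebraMap A B g) := by
  set N := powSuccSpan (d.localize M B) ((u : B) * algebraMap A B g) with hN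
  refine powSuccSpan_le_of_stable d g (N.toAddSubgroup.comap (symbolMap M d g u))
    ?_ ?_ ?_ ?_ hx
  · change symbolMap M d g u (PowModule.mk d g _) ∈ N
    -- The generator `g` goes to `u⁻¹ · (u g)`.
    have := C_mul_mem (N := N) _ _ (u⁻¹ : Bˣ) (Submodule.mem_span_singleton_self _)
    rw [← Polynomial.C_mul, ← map_mul, Units.inv_mul_cancel_left] at this
    rwa [symbolMap_mk, Polynomial.map_C, awayMap_algebraMap]
  · intro a y hy
    change symbolMap M d g u (PowModule.mk d g y) ∈ N at hy
    change symbolMap M d g u (PowModule.mk d g _) ∈ N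
    rw [symbolMap_mk] at hy ⊢
    rw [Polynomial.map_mul, Polynomial.map_C, awayMap_algebraMap]
    exact C_mul_mem _ _ _ hy
  · intro y hy
    change symbolMap M d g u (PowModule.mk d g y) ∈ N at hy
    change symbolMap M d g u (PowModule.mk d g _) ∈ N
    rw [symbolMap_mk] at hy ⊢
    rw [Polynomial.map_mul, Polynomial.map_X]
    exact X_mul_mem _ _ hy
  · intro i y hy
    change symbolMap M d g u (PowModule.mk d g y) ∈ N at hy
    change symbolMap M d g u (PowModule.pd d g i (PowModule.mk d g y)) ∈ N
    have h := pd_symbolMap M d g u i y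
    rw [← sub_eq_iff_eq_add] at h
    rw [← h]
    exact N.sub_mem (pd_mem _ _ i hy) (C_mul_mem _ _ _ (X_mul_mem _ _ hy))

theorem isBernsteinPolynomial_localize {p : ℂ[X]} (hp : IsBernsteinPolynomial d g p) :
    IsBernsteinPolynomial (d.localize M B) ((u : B) * algebraMap A B g) p := by
  have := symbolMap_mem M d g u hp
  rwa [symbolMap_mk, Polynomial.map_map, awayMap_comp_algebraMap] at this

/-- The elements of `B_{ug}[s] (ug)^s` that a denominator in `M` brings into the image of
`D_A[s] g^(s+1)`. -/
def denominatorSubgroup :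
    AddSubgroup (PowModule (d.localize M B) ((u : B) * algebraMap A B g)) where
  carrier := {z | ∃ m ∈ M, ∃ x ∈ powSuccSpan d g,
    PowModule.mulBy _ _ (Polynomial.C (algebraMap B _ (algebraMap A B m))) z =
      symbolMap M d g u x}
  zero_mem' := ⟨1, M.one_mem, 0, Submodule.zero_mem _, by rw [map_zero, map_zero]⟩
  neg_mem' := by
    rintro z ⟨m, hm, x, hx, h⟩
    exact ⟨m, hm, -x, Submodule.neg_mem _ hx, by rw [map_neg, map_neg, h]⟩
  add_mem' := by
    rintro z w ⟨m, hm, x, hx, h⟩ ⟨m', hm', x', hx', h'⟩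
    obtain ⟨z, rfl⟩ := (PowModule.mk _ _).surjective z
    obtain ⟨w, rfl⟩ := (PowModule.mk _ _).surjective w
    obtain ⟨x, rfl⟩ := (PowModule.mk _ _).surjective x
    obtain ⟨x', rfl⟩ := (PowModule.mk _ _).surjective x'
    refine ⟨m * m', M.mul_mem hm hm', _, Submodule.add_mem _ (C_mul_mem d g m' hx)
      (C_mul_mem d g m hx'), ?_⟩
    rw [PowModule.mulBy_mk, symbolMap_mk] at h h'
    replace h := (PowModule.mk _ _).injective h
    replace h' := (PowModule.mk _ _).injective h'
    rw [← map_add, ← map_add, PowModule.mulBy_mk, symbolMap_mk, Polynomial.map_add,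
      Polynomial.map_mul, Polynomial.map_mul, ← h, ← h', Polynomial.map_C, Polynomial.map_C,
      awayMap_algebraMap, awayMap_algebraMap, map_mul (algebraMap A B),
      map_mul (algebraMap B _), Polynomial.C_mul]
    congr 1
    ring

theorem mk_mem_denominatorSubgroup {z} :
    PowModule.mk _ _ z ∈ denominatorSubgroup M d g u ↔ ∃ m ∈ M, ∃ x,
      PowModule.mk d g x ∈ powSuccSpan d g ∧
      Polynomial.C (algebraMap B _ (algebraMap A B m)) * z = x.map (awayMap g u) := Iff.rfl

theorem denominatorSubgroup_of_mul {m : A} (hm : m ∈ M) {z}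
    (h : PowModule.mk _ _ (Polynomial.C (algebraMap B _ (algebraMap A B m)) * z) ∈
      denominatorSubgroup M d g u) :
    PowModule.mk _ _ z ∈ denominatorSubgroup M d g u := by
  rw [mk_mem_denominatorSubgroup] at h ⊢
  obtain ⟨m', hm', x, hx, h⟩ := h
  refine ⟨m' * m, M.mul_mem hm' hm, x, hx, ?_⟩
  rw [← h, map_mul, map_mul, Polynomial.C_mul, mul_assoc]

/-- Write `b = a / m`: the numerator acts on `D[s] g^(s+1)` and the denominator is absorbed. -/
theorem denominatorSubgroup_mul (b : B) {z}
    (h : PowModule.mk _ _ z ∈ denominatorSubgroup M d g u) :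
    PowModule.mk _ _ (Polynomial.C (algebraMap B _ b) * z) ∈ denominatorSubgroup M d g u := by
  obtain ⟨⟨a, m⟩, hm⟩ := IsLocalization.surj M b
  refine denominatorSubgroup_of_mul M d g u m.2 ?_
  rw [← mul_assoc, ← Polynomial.C_mul, ← map_mul, mul_comm (algebraMap A B m), hm]
  rw [mk_mem_denominatorSubgroup] at h ⊢
  obtain ⟨m', hm', x, hx, h⟩ := h
  refine ⟨m', hm', _, C_mul_mem d g a hx, ?_⟩
  rw [mul_left_comm, h, Polynomial.map_mul, Polynomial.map_C, awayMap_algebraMap]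

theorem denominatorSubgroup_X_mul {z}
    (h : PowModule.mk _ _ z ∈ denominatorSubgroup M d g u) :
    PowModule.mk _ _ (Polynomial.X * z) ∈ denominatorSubgroup M d g u := by
  rw [mk_mem_denominatorSubgroup] at h ⊢
  obtain ⟨m', hm', x, hx, h⟩ := h
  refine ⟨m', hm', _, X_mul_mem d g hx, ?_⟩
  rw [mul_left_comm, h, Polynomial.map_mul, Polynomial.map_X]

theorem symbolMap_mem_denominatorSubgroup {x} (hx : x ∈ powSuccSpan d g) :
    symbolMap M d g u x ∈ denominatorSubgroup M d g u := by
  refine ⟨1, M.one_mem, x, hx, ?_⟩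
  rw [map_one, map_one, map_one, map_one, Module.End.one_apply]

/-- If `m` clears the denominator of `z`, then `m ∂_i z = ∂_i(m z) - ∂_i(m) z`. The first term is
the derivative of an image under `symbolMap`, the second a multiple of `z`. -/
theorem denominatorSubgroup_pd (i : Fin n) {z}
    (h : PowModule.mk _ _ z ∈ denominatorSubgroup M d g u) :
    PowModule.pd _ _ i (PowModule.mk _ _ z) ∈ denominatorSubgroup M d g u := by
  have h' := h
  rw [mk_mem_denominatorSubgroup] at h'
  obtain ⟨m, hm, x, hx, hx'⟩ := h'
  rw [PowModule.pd_mk]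
  refine denominatorSubgroup_of_mul M d g u hm ?_
  have h1 : PowModule.pd (d.localize M B) _ i (symbolMap M d g u (PowModule.mk d g x)) ∈
      denominatorSubgroup M d g u := by
    rw [pd_symbolMap]
    exact AddSubgroup.add_mem _ (symbolMap_mem_denominatorSubgroup M d g u (pd_mem d g i hx))
      (denominatorSubgroup_mul M d g u _ (denominatorSubgroup_X_mul M d g u
        (symbolMap_mem_denominatorSubgroup M d g u hx)))
  rw [symbolMap_mk, ← hx', PowModule.pd_mk] at h1
  have h2 := AddSubgroup.sub_mem _ h1
    (denominatorSubgroup_mul M d g u ((d.localize M B).der i (algebraMap A B m)) h)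
  rw [← map_sub] at h2
  convert h2 using 2
  rw [Derivation.leibniz, coeffDer_C, extendDer_algebraMap, smul_eq_mul, smul_eq_mul]
  ring

theorem exists_denominator {p : ℂ[X]}
    (hp : IsBernsteinPolynomial (d.localize M B) ((u : B) * algebraMap A B g) p) :
    ∃ m ∈ M, ∃ x, PowModule.mk d g x ∈ powSuccSpan d g ∧
      (Polynomial.C (algebraMap A _ m) * p.map (algebraMap ℂ (Localization.Away g))).map
        (awayMap g u) = x.map (awayMap g u) := by
  have h : PowModule.mk _ _ (p.map (algebraMap ℂ _)) ∈ denominatorSubgroup M d g u := by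
    refine powSuccSpan_le_of_stable (d.localize M B) _ (denominatorSubgroup M d g u) ?_
      (fun b y hy => denominatorSubgroup_mul M d g u b hy)
      (fun y hy => denominatorSubgroup_X_mul M d g u hy)
      (fun i y hy => denominatorSubgroup_pd M d g u i hy) hp
    -- The generator `u g` is a `B`-multiple of the image of `g`, which has denominator 1.
    rw [map_mul, Polynomial.C_mul]
    refine denominatorSubgroup_mul M d g u _ ?_
    have := symbolMap_mem_denominatorSubgroup M d g u
      (Submodule.mem_span_singleton_self (PowModule.mk d g (Polynomial.C (algebraMap A _ g))))
    rwa [symbolMap_mk, Polynomial.map_C, awayMap_algebraMap] at this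
  rw [mk_mem_denominatorSubgroup] at h
  obtain ⟨m, hm, x, hx, h⟩ := h
  refine ⟨m, hm, x, hx, ?_⟩
  rw [← h, Polynomial.map_mul, Polynomial.map_C, awayMap_algebraMap, Polynomial.map_map,
    awayMap_comp_algebraMap]

/-- Over a domain `A_g → B_{ug}` is injective, so the relation with cleared denominators already
holds over `A_g`. -/
theorem exists_mul_mem_powSuccSpan [IsDomain A] (hM : M ≤ nonZeroDivisors A) (hg : g ≠ 0)
    {p : ℂ[X]}
    (hp : IsBernsteinPolynomial (d.localize M B) ((u : B) * algebraMap A B g) p) :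
    ∃ m ∈ M, PowModule.mk d g
      (Polynomial.C (algebraMap A _ m) * p.map (algebraMap ℂ (Localization.Away g))) ∈
        powSuccSpan d g := by
  obtain ⟨m, hm, x, hx, h⟩ := exists_denominator M d g u hp
  refine ⟨m, hm, ?_⟩
  rwa [Polynomial.map_injective _ (awayMap_injective M g u hM hg) h]

end Transfer

/-! ### The Euler field at `q` and removal of the denominator -/

section Euler

variable {n : ℕ} (q : Fin n → ℂ)

/-- The Euler vector field `∑ (xᵢ - qᵢ) ∂ᵢ` centered at `q`. -/
def eulerAt : Derivation ℂ (MvPolynomial (Fin n) ℂ) (MvPolynomial (Fin n) ℂ) :=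
  ∑ i, (MvPolynomial.X i - MvPolynomial.C (q i)) • MvPolynomial.pderiv i

theorem eulerAt_apply (h : MvPolynomial (Fin n) ℂ) :
    eulerAt q h =
      ∑ i, (MvPolynomial.X i - MvPolynomial.C (q i)) * MvPolynomial.pderiv i h := by
  refine (congrFun (map_sum (Derivation.coeFnAddMonoidHom (R := ℂ) (A := MvPolynomial (Fin n) ℂ)
    (M := MvPolynomial (Fin n) ℂ)) _ _) h).trans ?_
  rw [Finset.sum_apply]
  rfl

theorem eulerAt_X (i : Fin n) :
    eulerAt q (MvPolynomial.X i) = MvPolynomial.X i - MvPolynomial.C (q i) := by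
  rw [eulerAt_apply, Finset.sum_eq_single i]
  · rw [MvPolynomial.pderiv_X_self, mul_one]
  · intro j _ hj
    rw [MvPolynomial.pderiv_X_of_ne hj.symm, mul_zero]
  · exact fun h => absurd (Finset.mem_univ i) h

theorem eval_eulerAt (h : MvPolynomial (Fin n) ℂ) :
    MvPolynomial.eval q (eulerAt q h) = 0 := by
  rw [eulerAt_apply, map_sum]
  exact Finset.sum_eq_zero fun i _ => by simp

/-- Split `E` as `∑ x_i ∂_i - ∑ q_i ∂_i`: the first sum multiplies a monomial by its degree, the
second lowers the degree. Expanding in powers of `x` rather than `x - q` avoids a change of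
coordinates. -/
theorem coeff_eulerAt (h : MvPolynomial (Fin n) ℂ) (m : Fin n →₀ ℕ) :
    (eulerAt q h).coeff m = m.degree * h.coeff m -
      ∑ i, q i * (h.coeff (m + Finsupp.single i 1) * (m i + 1)) := by
  rw [eulerAt_apply, MvPolynomial.coeff_sum, Finsupp.degree_eq_sum, Nat.cast_sum,
    Finset.sum_mul, ← Finset.sum_sub_distrib]
  refine Finset.sum_congr rfl fun i _ => ?_
  rw [sub_mul, MvPolynomial.coeff_sub, MvPolynomial.coeff_C_mul, MvPolynomial.coeff_pderiv,
    MvPolynomial.coeff_X_mul']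
  congr 1
  split_ifs with hi
  · have hi' : m i ≠ 0 := Finsupp.mem_support_iff.1 hi
    rw [MvPolynomial.coeff_pderiv, Finsupp.sub_add_single_one_cancel hi', mul_comm]
    congr 1
    rw [Finsupp.tsub_apply, Finsupp.single_eq_same, Nat.cast_sub (Nat.one_le_iff_ne_zero.2 hi')]
    simp
  · rw [Finsupp.notMem_support_iff.1 hi, Nat.cast_zero, zero_mul]

/-- On the part of degree `k + 1`, the highest possible, `E` is multiplication by `k + 1` up to
lower degree, so `E - (k + 1)` cancels that part. -/
theorem coeff_eulerAt_sub_eq_zero {k : ℕ} {h : MvPolynomial (Fin n) ℂ}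
    (hk : ∀ m : Fin n →₀ ℕ, k + 1 < m.degree → h.coeff m = 0) (m : Fin n →₀ ℕ)
    (hm : k < m.degree) :
    (eulerAt q h - MvPolynomial.C ((k + 1 : ℕ) : ℂ) * h).coeff m = 0 := by
  have hsum : ∑ i, q i * (h.coeff (m + Finsupp.single i 1) * (m i + 1)) = 0 :=
    Finset.sum_eq_zero fun i _ => by
      rw [hk _ (by rw [map_add, Finsupp.degree_single]; omega), zero_mul, mul_zero]
  rw [MvPolynomial.coeff_sub, MvPolynomial.coeff_C_mul, coeff_eulerAt, hsum, sub_zero]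
  rcases (Nat.succ_le_of_lt hm).eq_or_lt with h' | h'
  · rw [← h', sub_self]
  · rw [hk m h', mul_zero, mul_zero, sub_zero]

/-- An ideal stable under the Euler vector field at `q` and not contained in the maximal ideal
of `q` is the unit ideal. -/
theorem eq_top_of_eulerAt_stable {J : Ideal (MvPolynomial (Fin n) ℂ)}
    (hJ : ∀ h ∈ J, eulerAt q h ∈ J) {h : MvPolynomial (Fin n) ℂ} (hh : h ∈ J)
    (hq : MvPolynomial.eval q h ≠ 0) : J = ⊤ := by
  have key (k : ℕ) (h : MvPolynomial (Fin n) ℂ)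
      (hk : ∀ m : Fin n →₀ ℕ, k < m.degree → h.coeff m = 0) (hh : h ∈ J)
      (hq : MvPolynomial.eval q h ≠ 0) : J = ⊤ := by
    induction k generalizing h with
    | zero =>
      have hC : h = MvPolynomial.C (h.coeff 0) := by
        ext m
        rw [MvPolynomial.coeff_C]
        split_ifs with hm
        · rw [hm]
        · exact hk m (Nat.pos_of_ne_zero fun h0 => hm ((Finsupp.degree_eq_zero_iff m).1 h0).symm)
      rw [hC, MvPolynomial.eval_C] at hq
      rw [hC] at hh
      exact Ideal.eq_top_of_isUnit_mem _ hh ((isUnit_iff_ne_zero.2 hq).map MvPolynomial.C)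
    | succ k ih =>
      -- Replace `h` by `E(h) - (k + 1) h`. As `E(h)` vanishes at `q`, the new value there is `-(k +
      -- 1) h(q)`, still nonzero.
      refine ih _ (coeff_eulerAt_sub_eq_zero q hk)
        (J.sub_mem (hJ h hh) (J.mul_mem_left _ hh)) ?_
      rw [map_sub, eval_eulerAt, zero_sub, map_mul, MvPolynomial.eval_C]
      exact neg_ne_zero.2 (mul_ne_zero (Nat.cast_ne_zero.2 k.succ_ne_zero) hq)
  exact key h.totalDegree h
    (fun m hm => MvPolynomial.coeff_eq_zero_of_totalDegree_lt hm) hh hq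

theorem coeffDer_map_algebraMap {R : Type*} [CommRing R] [Algebra ℂ R] (δ : Derivation ℂ R R)
    (p : ℂ[X]) : coeffDer δ (p.map (algebraMap ℂ R)) = 0 := by
  ext k
  rw [coeff_coeffDer, Polynomial.coeff_map, Derivation.map_algebraMap, Polynomial.coeff_zero]

theorem pd_C_mul_map {A : Type*} [CommRing A] [Algebra ℂ A] (d : Partials n A) (g h : A)
    (p : ℂ[X]) (i : Fin n) :
    PowModule.pd d g i (PowModule.mk d g (Polynomial.C (algebraMap A _ h) *
      p.map (algebraMap ℂ (Localization.Away g)))) =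
    PowModule.mk d g (Polynomial.C (algebraMap A _ (d.der i h)) * p.map (algebraMap ℂ _) +
      Polynomial.C (logDer d g i) *
        (Polynomial.X * (Polynomial.C (algebraMap A _ h) * p.map (algebraMap ℂ _)))) := by
  rw [PowModule.pd_mk, Derivation.leibniz, coeffDer_map_algebraMap, smul_zero, zero_add,
    coeffDer_C, extendDer_algebraMap, smul_eq_mul]
  congr 1
  ring

/-- The polynomials `h` with `h p(s) g^s ∈ D[s] g^(s+1)`. -/
def multiplierIdeal {A : Type*} [CommRing A] [Algebra ℂ A] (d : Partials n A) (g : A)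
    (p : ℂ[X]) : Ideal A where
  carrier := {h | PowModule.mk d g (Polynomial.C (algebraMap A _ h) *
    p.map (algebraMap ℂ (Localization.Away g))) ∈ powSuccSpan d g}
  zero_mem' := by
    change PowModule.mk d g _ ∈ powSuccSpan d g
    rw [map_zero, Polynomial.C_0, zero_mul, map_zero]
    exact Submodule.zero_mem _
  add_mem' {a b} ha hb := by
    change PowModule.mk d g _ ∈ powSuccSpan d g
    rw [map_add, Polynomial.C_add, add_mul, map_add]
    exact Submodule.add_mem _ ha hb
  smul_mem' a b hb := by
    change PowModule.mk d g _ ∈ powSuccSpan d g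
    rw [smul_eq_mul, map_mul (algebraMap A _), Polynomial.C_mul, mul_assoc]
    exact C_mul_mem d g a hb

theorem mem_multiplierIdeal {A : Type*} [CommRing A] [Algebra ℂ A] {d : Partials n A} {g : A}
    {p : ℂ[X]} {h : A} : h ∈ multiplierIdeal d g p ↔
      PowModule.mk d g (Polynomial.C (algebraMap A _ h) *
        p.map (algebraMap ℂ (Localization.Away g))) ∈ powSuccSpan d g := Iff.rfl

theorem sum_mul_logDer {g : MvPolynomial (Fin n) ℂ} {c : ℂ}
    (hc : eulerAt q g = MvPolynomial.C c * g) :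
    ∑ i, algebraMap (MvPolynomial (Fin n) ℂ) (Localization.Away g)
      (MvPolynomial.X i - MvPolynomial.C (q i)) *
      logDer (stdPartials n) g i =
      algebraMap (MvPolynomial (Fin n) ℂ) _ (MvPolynomial.C c) := by
  simp only [logDer, ← mul_assoc, ← Finset.sum_mul, ← map_mul]
  rw [← map_sum]
  have h := eulerAt_apply q g
  rw [hc] at h
  change algebraMap _ (Localization.Away g) (∑ i, (MvPolynomial.X i - MvPolynomial.C (q i)) *
    MvPolynomial.pderiv i g) * _ = _
  rw [← h, map_mul, mul_assoc, IsLocalization.Away.mul_invSelf, mul_one]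

/-- Applying `∑ (x_i - q_i) ∂_i` to `h p(s) g^s` gives `(E(h) + c s h) p(s) g^s`, and `c s h p(s)
g^s` is already in the submodule. -/
theorem eulerAt_mem_multiplierIdeal {g : MvPolynomial (Fin n) ℂ} {c : ℂ}
    (hc : eulerAt q g = MvPolynomial.C c * g) {p : ℂ[X]} {h : MvPolynomial (Fin n) ℂ}
    (hh : h ∈ multiplierIdeal (stdPartials n) g p) :
    eulerAt q h ∈ multiplierIdeal (stdPartials n) g p := by
  rw [mem_multiplierIdeal] at hh ⊢
  set y := p.map (algebraMap ℂ (Localization.Away g))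
  have h1 := Submodule.sum_mem (t := Finset.univ) _ fun i _ =>
    C_mul_mem (stdPartials n) g (MvPolynomial.X i - MvPolynomial.C (q i))
      ((pd_C_mul_map (stdPartials n) g h p i) ▸ pd_mem (stdPartials n) g i hh)
  have h2 := C_mul_mem (stdPartials n) g (MvPolynomial.C c) (X_mul_mem (stdPartials n) g hh)
  have h3 := Submodule.sub_mem _ h1 h2
  rw [← map_sum, ← map_sub] at h3
  convert h3 using 2
  simp only [mul_add, Finset.sum_add_distrib, ← mul_assoc, ← Polynomial.C_mul, ← Finset.sum_mul,
    ← map_sum, sum_mul_logDer q hc]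
  rw [add_sub_cancel_right, eulerAt_apply, map_sum]
  simp only [map_mul]
  rfl

theorem isBernsteinPolynomial_of_denominator {g : MvPolynomial (Fin n) ℂ} {c : ℂ}
    (hc : eulerAt q g = MvPolynomial.C c * g) {p : ℂ[X]} {h : MvPolynomial (Fin n) ℂ}
    (hh : h ∈ multiplierIdeal (stdPartials n) g p) (hq : MvPolynomial.eval q h ≠ 0) :
    IsBernsteinPolynomial (stdPartials n) g p := by
  have h1 : (1 : MvPolynomial (Fin n) ℂ) ∈ multiplierIdeal (stdPartials n) g p := by
    rw [eq_top_of_eulerAt_stable q (fun _ => eulerAt_mem_multiplierIdeal q hc) hh hq]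
    exact Submodule.mem_top
  rwa [mem_multiplierIdeal, map_one, Polynomial.C_1, one_mul] at h1

/-- If `g` is an eigenvector of the Euler vector field at `q` and `v(q) ≠ 0`, then the local
`b`-function of `v g` at `q` is the global `b`-function of `g`. -/
theorem localBFunction_mul_eq_bFunction {g v : MvPolynomial (Fin n) ℂ} {c : ℂ} (hg : g ≠ 0)
    (hc : eulerAt q g = MvPolynomial.C c * g) (hv : MvPolynomial.eval q v ≠ 0) :
    localBFunction (v * g) q = bFunction g := by
  -- As `v(q) ≠ 0`, `v` becomes a unit of the local ring, the `u` of the comparison above.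
  obtain ⟨u, hu⟩ := IsLocalization.map_units (M := (pointIdeal q).primeCompl) (LocalRingAt q)
    ⟨v, hv⟩
  change (u : LocalRingAt q) = algebraMap _ _ v at hu
  rw [localBFunction, bFunction, map_mul, ← hu]
  refine bernsteinSato_congr fun p => ⟨fun hp => ?_, fun hp =>
    isBernsteinPolynomial_localize (pointIdeal q).primeCompl (stdPartials n) g u hp⟩
  obtain ⟨m, hm, h⟩ := exists_mul_mem_powSuccSpan (pointIdeal q).primeCompl (stdPartials n) g u
    (pointIdeal q).primeCompl_le_nonZeroDivisors hg hp
  exact isBernsteinPolynomial_of_denominator q hc h hm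

end Euler

/-! ### Factors of the Vandermonde determinant -/

section Vandermonde

variable {n : ℕ} (q : Fin n → ℂ)

/-- The blocks are disjoint, so the sets of pairs inside them are too, and the double product runs
once over each pair `i < j` in a common block. -/
theorem vandermondePartition_eq_prod (P : Finpartition (Finset.univ : Finset (Fin n)))
    (hP : ∀ i j : Fin n, (∃ S ∈ P.parts, i ∈ S ∧ j ∈ S) ↔ q i = q j) :
    vandermondePartition P =
      ∏ p ∈ ((Finset.univ ×ˢ Finset.univ).filter
        (fun p : Fin n × Fin n => p.1 < p.2)).filter (fun p => q p.1 = q p.2),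
        (MvPolynomial.X p.1 - MvPolynomial.X p.2) := by
  have hdisj : (P.parts : Set (Finset (Fin n))).PairwiseDisjoint
      fun S => (S ×ˢ S).filter (fun p : Fin n × Fin n => p.1 < p.2) := by
    intro S hS T hT hST
    refine Finset.disjoint_left.2 fun x hx hx' => ?_
    rw [Finset.mem_filter, Finset.mem_product] at hx hx'
    exact Finset.disjoint_left.1 (P.disjoint hS hT hST) hx.1.1 hx'.1.1
  rw [vandermondePartition]
  simp only [vandermondeOn]
  rw [← Finset.prod_biUnion hdisj]
  refine Finset.prod_congr ?_ fun _ _ => rfl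
  ext x
  simp only [Finset.mem_biUnion, Finset.mem_filter, Finset.mem_product, Finset.mem_univ,
    true_and, ← hP]
  constructor
  · rintro ⟨S, hS, hx, hlt⟩
    exact ⟨hlt, S, hS, hx⟩
  · rintro ⟨hlt, S, hS, hx⟩
    exact ⟨S, hS, hx, hlt⟩

/-- If `q_i = q_j` then `x_i - x_j = (x_i - q_i) - (x_j - q_j)` has eigenvalue 1, and eigenvalues
add under products by the Leibniz rule. -/
theorem exists_eulerAt_prod_eq (s : Finset (Fin n × Fin n)) (hs : ∀ p ∈ s, q p.1 = q p.2) :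
    ∃ c : ℂ, eulerAt q (∏ p ∈ s, (MvPolynomial.X p.1 - MvPolynomial.X p.2)) =
      MvPolynomial.C c * ∏ p ∈ s, (MvPolynomial.X p.1 - MvPolynomial.X p.2) := by
  induction s using Finset.induction_on with
  | empty => exact ⟨0, by simp⟩
  | insert p s hp ih =>
    obtain ⟨c, hc⟩ := ih fun p hp => hs p (Finset.mem_insert_of_mem hp)
    refine ⟨c + 1, ?_⟩
    rw [Finset.prod_insert hp, Derivation.leibniz, hc, map_sub, eulerAt_X, eulerAt_X,
      hs p (Finset.mem_insert_self p s), smul_eq_mul, smul_eq_mul, map_add, map_one]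
    ring

end Vandermonde

end BernsteinSato

theorem mainTheorem5 (n : ℕ) (q : Fin n → ℂ)
    (P : Finpartition (Finset.univ : Finset (Fin n)))
    (hP : ∀ i j : Fin n, (∃ S ∈ P.parts, i ∈ S ∧ j ∈ S) ↔ q i = q j) :
    BernsteinSato.localBFunction (BernsteinSato.vandermonde n) q =
      BernsteinSato.bFunction (BernsteinSato.vandermondePartition P) := by
  -- Factor `ξ_n` as `v g`, with the pairs `q_i ≠ q_j` in `v` and the pairs `q_i = q_j` in `g =
  -- ξ_P`.
  rw [BernsteinSato.vandermondePartition_eq_prod q P hP, BernsteinSato.vandermonde,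
    BernsteinSato.vandermondeOn, ← Finset.prod_filter_not_mul_prod_filter _
      (fun p : Fin n × Fin n => q p.1 = q p.2)]
  obtain ⟨c, hc⟩ := BernsteinSato.exists_eulerAt_prod_eq q _
    fun p hp => (Finset.mem_filter.1 hp).2
  refine BernsteinSato.localBFunction_mul_eq_bFunction q ?_ hc ?_
  · refine Finset.prod_ne_zero_iff.2 fun p hp => sub_ne_zero.2 fun h => ?_
    exact (Finset.mem_filter.1 (Finset.mem_filter.1 hp).1).2.ne (MvPolynomial.X_injective h)
  · rw [map_prod]
    refine Finset.prod_ne_zero_iff.2 fun p hp => ?_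
    rw [map_sub, MvPolynomial.eval_X, MvPolynomial.eval_X]
    exact sub_ne_zero.2 (Finset.mem_filter.1 hp).2

end
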